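/- Let $k$ be a field and let $(A,\delta,\epsilon)$ be a coalgebra over $k$ which is split, i.e. $\mathrm{End}_A(V)=k$ for every irreducible right $A$-comodule $V$. A finite-dimensional $k$-algebra $S$ is called quasi-hereditary if, for some labelling $L(\lambda)$, $\lambda\in\Lambda$, of a complete set of pairwise non-isomorphic simple left $S$-modules and some partial order $\le$ on the finite set $\Lambda$, the category of finite-dimensional left $S$-modules is a highest weight category. That is: let $I(\lambda)$ be the injective envelope of $L(\lambda)$ and let $\nabla(\lambda)$ be the largest submodule of $I(\lambda)$ containing $L(\lambda)$ such that all composition factors of $\nabla(\lambda)/L(\lambda)$ are of the form $L(\mu)$ with $\mu<\lambda$; then, for each $\lambda\in\Lambda$, the module $I(\lambda)$ is finite-dimensional and $I(\lambda)/\nabla(\lambda)$ has a finite filtration each of whose sections is isomorphic to $\nabla(\mu)$ for some $\mu>\lambda$. A finite-dimensional coalgebra $B$ is called quasi-hereditary if its dual algebra $B^*$, with the convolution product, is quasi-hereditary. The coalgebra $A$ is called locally quasi-hereditary if each finite-dimensional subcoalgebra of $A$ is contained in a (finite-dimensional) quasi-hereditary subcoalgebra of $A$. Put $C(A)=\{f\in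 A\mid T(\delta(f))=\delta(f)\}$, where $T:A\otimes A\to A\otimes A$ is the twist map. For a finite-dimensional right $A$-comodule $V$ with structure map $\tau:V\to V\otimes A$ and a basis $v_1,\dots,v_n$, write $\tau(v_i)=\sum_j v_j\otimes f_{ji}$; the character of $V$ is $\chi_V=f_{11}+\cdots+f_{nn}\in A$, which does not depend on the basis. Let $C_0(A)$ be the $k$-span of all $\chi_V$, for $V$ a finite-dimensional right $A$-comodule. The coalgebra $A$ is called constrained if $C_0(A)=C(A)$. **Proposition 5.2.** If the split coalgebra $A$ is locally quasi-hereditary then it is constrained, i.e. $C_0(A)=C(A)$. -/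

import Mathlib

open scoped TensorProduct

universe u v w

namespace ConstrainedCoalgebra

section HighestWeight

variable {S : Type w} [Ring S]

/-- Every composition factor of `B / A`, for submodules `A ≤ B` of `X`, is isomorphic to `L μ` for
some `μ ∈ π`. A composition factor is a simple quotient `U / W` with `A ≤ W ≤ U ≤ B`, that is, one
for which `U` covers `W`. -/
def FactorsIn {Λ : Type} (L : Λ → ModuleCat.{u} S) (π : Set Λ) {X : Type u} [AddCommGroup X]
    [Module S X] (A B : Submodule S X) : Prop :=
  ∀ W U : Submodule S X, A ≤ W → W ⋖ U → U ≤ B →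
    ∃ μ ∈ π, Nonempty ((U ⧸ W.submoduleOf U) ≃ₗ[S] L μ)

/-- `j : M → I` is an injective envelope of `M`: `I` is injective and `j` is an essential
monomorphism. -/
structure IsInjectiveEnvelope {M I : Type u} [AddCommGroup M] [AddCommGroup I] [Module S M]
    [Module S I] (j : M →ₗ[S] I) : Prop where
  injective_module : Module.Injective S I
  injective : Function.Injective j
  essential : ∀ N : Submodule S I, N ≠ ⊥ → N ⊓ LinearMap.range j ≠ ⊥

variable (S) in
/-- The data and conditions making the category of finitely generated left `S`-modules (for `S` a
finite-dimensional algebra: of finite-dimensional left `S`-modules) a highest weight category with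
respect to the partially ordered set `Λ`. Writing `I λ` for the injective envelope of `L λ`, the
costandard module `∇ λ` is the largest submodule of `I λ` that contains `L λ` and for which all
composition factors of `∇ λ / L λ` are of the form `L μ` with `μ < λ`. It is required that
`I λ / ∇ λ` has a filtration whose sections are costandard modules `∇ μ` with `μ > λ`. -/
structure HighestWeightStructure (Λ : Type) [PartialOrder Λ] where
  /-- the simple modules -/
  L : Λ → ModuleCat.{u} S
  simple : ∀ l, IsSimpleModule S (L l)
  eq_of_iso : ∀ l m, Nonempty (L l ≃ₗ[S] L m) → l = m
  complete : ∀ V : ModuleCat.{u} S, IsSimpleModule S V → ∃ l, Nonempty (V ≃ₗ[S] L l)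
  /-- the injective envelopes of the simple modules -/
  I : Λ → ModuleCat.{u} S
  finite_I : ∀ l, Module.Finite S (I l)
  /-- the embedding of a simple module in its injective envelope -/
  j : ∀ l, L l →ₗ[S] I l
  envelope : ∀ l, IsInjectiveEnvelope (j l)
  /-- the costandard modules -/
  nabla : ∀ l, Submodule S (I l)
  nabla_isGreatest : ∀ l, IsGreatest
    {N : Submodule S (I l) |
      LinearMap.range (j l) ≤ N ∧ FactorsIn L (Set.Iio l) (LinearMap.range (j l)) N} (nabla l)
  filtration : ∀ l, ∃ (n : ℕ) (F : ℕ → Submodule S (I l)), F 0 = nabla l ∧ F n = ⊤ ∧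
    ∀ i < n, F i ≤ F (i + 1) ∧
      ∃ m, l < m ∧ Nonempty ((F (i + 1) ⧸ (F i).submoduleOf (F (i + 1))) ≃ₗ[S] nabla m)

/-- A `k`-algebra `S` is quasi-hereditary if it is finite-dimensional and its finite-dimensional
left modules form a highest weight category, for some labelling of the simple modules and some
partial order on the (finite) set of labels. Modules are taken in the universe of `k`, which
contains a copy of every finite-dimensional module. -/
def IsQuasiHereditaryAlgebra (k : Type u) (S : Type w) [Field k] [Ring S] [Algebra k S] : Prop :=
  Module.Finite k S ∧ ∃ (Λ : Type) (_ : Finite Λ) (_ : PartialOrder Λ),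
    Nonempty (HighestWeightStructure.{u, w} S Λ)

end HighestWeight

section Subcoalgebra

variable {k : Type u} {A : Type v} [Field k] [AddCommGroup A] [Module k A] [Coalgebra k A]

variable (k A) in
/-- A subcoalgebra of `A`: a subspace `B` such that `δ(B)` lies in `B ⊗ B ⊆ A ⊗ A`. -/
structure Subcoalgebra where
  /-- the underlying subspace -/
  carrier : Submodule k A
  comul_mem : ∀ b ∈ carrier, Coalgebra.comul (R := k) b ∈
    LinearMap.range (TensorProduct.map carrier.subtype carrier.subtype)

namespace Subcoalgebra

variable (B : Subcoalgebra k A)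

lemma map_subtype_injective :
    Function.Injective (TensorProduct.map B.carrier.subtype B.carrier.subtype) :=
  TensorProduct.map_injective_of_flat_flat _ _ B.carrier.injective_subtype
    B.carrier.injective_subtype

/-- The comultiplication of a subcoalgebra, the restriction of that of `A`. -/
noncomputable def comulRestrict : B.carrier →ₗ[k] B.carrier ⊗[k] B.carrier :=
  (LinearEquiv.ofInjective _ B.map_subtype_injective).symm.toLinearMap ∘ₗ
    LinearMap.codRestrict _ (Coalgebra.comul ∘ₗ B.carrier.subtype) fun b => B.comul_mem b b.2

lemma map_comp_comulRestrict :
    TensorProduct.map B.carrier.subtype B.carrier.subtype ∘ₗ B.comulRestrict =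
      Coalgebra.comul ∘ₗ B.carrier.subtype := by
  ext b
  exact congrArg Subtype.val ((LinearEquiv.ofInjective _ B.map_subtype_injective).apply_symm_apply
    (LinearMap.codRestrict _ (Coalgebra.comul ∘ₗ B.carrier.subtype)
      (fun b => B.comul_mem b b.2) b))

lemma map_comulRestrict (b : B.carrier) :
    TensorProduct.map B.carrier.subtype B.carrier.subtype (B.comulRestrict b) =
      Coalgebra.comul (R := k) (b : A) :=
  LinearMap.congr_fun B.map_comp_comulRestrict b

noncomputable instance : Coalgebra k B.carrier where
  comul := B.comulRestrict
  counit := Coalgebra.counit ∘ₗ B.carrier.subtype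
  coassoc := by
    have hinj : Function.Injective (TensorProduct.map B.carrier.subtype
        (TensorProduct.map B.carrier.subtype B.carrier.subtype)) :=
      TensorProduct.map_injective_of_flat_flat _ _ B.carrier.injective_subtype
        B.map_subtype_injective
    have h1 : ∀ t : B.carrier ⊗[k] B.carrier,
        TensorProduct.map B.carrier.subtype (TensorProduct.map B.carrier.subtype B.carrier.subtype)
          (TensorProduct.assoc k _ _ _ (B.comulRestrict.rTensor _ t)) =
        TensorProduct.assoc k A A A ((Coalgebra.comul (R := k)).rTensor A
          (TensorProduct.map B.carrier.subtype B.carrier.subtype t)) := by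
      intro t
      induction t with
      | zero => simp
      | add x y hx hy => simp only [map_add, hx, hy]
      | tmul x y =>
        simp only [LinearMap.rTensor_tmul, TensorProduct.map_tmul, Submodule.subtype_apply,
          ← map_comulRestrict]
        generalize B.comulRestrict x = z
        induction z with
        | zero => simp
        | add x y hx hy => simp only [map_add, TensorProduct.add_tmul, hx, hy]
        | tmul x y => simp
    have h2 : ∀ t : B.carrier ⊗[k] B.carrier,
        TensorProduct.map B.carrier.subtype (TensorProduct.map B.carrier.subtype B.carrier.subtype)
          (B.comulRestrict.lTensor _ t) =
        (Coalgebra.comul (R := k)).lTensor A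
          (TensorProduct.map B.carrier.subtype B.carrier.subtype t) := by
      intro t
      induction t with
      | zero => simp
      | add x y hx hy => simp only [map_add, hx, hy]
      | tmul x y => simp [map_comulRestrict]
    refine LinearMap.ext fun b => hinj ?_
    simp only [LinearMap.comp_apply, LinearEquiv.coe_coe]
    rw [h1, h2, map_comulRestrict, Coalgebra.coassoc_apply]
  rTensor_counit_comp_comul := by
    have h : ∀ t : B.carrier ⊗[k] B.carrier,
        B.carrier.subtype.lTensor k ((Coalgebra.counit ∘ₗ B.carrier.subtype).rTensor _ t) =
        (Coalgebra.counit (R := k)).rTensor A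
          (TensorProduct.map B.carrier.subtype B.carrier.subtype t) := by
      intro t
      induction t with
      | zero => simp
      | add x y hx hy => simp only [map_add, hx, hy]
      | tmul x y => simp
    refine LinearMap.ext fun b =>
      Module.Flat.lTensor_preserves_injective_linearMap _ B.carrier.injective_subtype ?_
    rw [LinearMap.comp_apply, h, map_comulRestrict, Coalgebra.rTensor_counit_comul]
    simp
  lTensor_counit_comp_comul := by
    have h : ∀ t : B.carrier ⊗[k] B.carrier,
        B.carrier.subtype.rTensor k ((Coalgebra.counit ∘ₗ B.carrier.subtype).lTensor _ t) =
        (Coalgebra.counit (R := k)).lTensor A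
          (TensorProduct.map B.carrier.subtype B.carrier.subtype t) := by
      intro t
      induction t with
      | zero => simp
      | add x y hx hy => simp only [map_add, hx, hy]
      | tmul x y => simp
    refine LinearMap.ext fun b =>
      Module.Flat.rTensor_preserves_injective_linearMap _ B.carrier.injective_subtype ?_
    rw [LinearMap.comp_apply, h, map_comulRestrict, Coalgebra.lTensor_counit_comul]
    simp

end Subcoalgebra

end Subcoalgebra

section Coalgebra

variable (k : Type u) (A : Type v) [Field k] [AddCommGroup A] [Module k A] [Coalgebra k A]

/-- A coalgebra is quasi-hereditary if it is finite-dimensional and its dual algebra (the linear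
dual with the convolution product) is quasi-hereditary. -/
def IsQuasiHereditaryCoalgebra : Prop :=
  Module.Finite k A ∧ IsQuasiHereditaryAlgebra k (WithConv (A →ₗ[k] k))

/-- Each finite-dimensional subcoalgebra is contained in a quasi-hereditary subcoalgebra. -/
def IsLocallyQuasiHereditary : Prop :=
  ∀ B : Subcoalgebra k A, Module.Finite k B.carrier →
    ∃ D : Subcoalgebra k A, B.carrier ≤ D.carrier ∧ IsQuasiHereditaryCoalgebra k D.carrier

/-- A right `A`-comodule structure on the vector space `V`. -/
structure RightComodule (V : Type u) [AddCommGroup V] [Module k V] where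
  /-- the structure map -/
  coact : V →ₗ[k] V ⊗[k] A
  coassoc : TensorProduct.assoc k V A A ∘ₗ coact.rTensor A ∘ₗ coact =
    (Coalgebra.comul (R := k) (A := A)).lTensor V ∘ₗ coact
  counit : TensorProduct.rid k V ∘ₗ (Coalgebra.counit (R := k) (A := A)).lTensor V ∘ₗ coact =
    LinearMap.id

namespace RightComodule

variable {k A} {V : Type u} [AddCommGroup V] [Module k V] (ρ : RightComodule k A V)

/-- `W` is a subcomodule: the structure map sends `W` into `W ⊗ A`. -/
def IsSubcomodule (W : Submodule k V) : Prop :=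
  ∀ x ∈ W, ρ.coact x ∈ LinearMap.range (W.subtype.rTensor A)

/-- The comodule is irreducible: nonzero, without proper nonzero subcomodules. -/
def IsIrreducible : Prop :=
  Nontrivial V ∧ ∀ W : Submodule k V, ρ.IsSubcomodule W → W = ⊥ ∨ W = ⊤

/-- `φ` is an endomorphism of the comodule. -/
def IsEndomorphism (φ : V →ₗ[k] V) : Prop :=
  ρ.coact ∘ₗ φ = φ.rTensor A ∘ₗ ρ.coact

/-- The coefficient elements `f j i` relative to a basis `b`, determined by
`ρ (b i) = ∑ j, b j ⊗ f j i`. -/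
noncomputable def coeff {ι : Type*} (b : Module.Basis ι k V) (j i : ι) : A :=
  TensorProduct.lid k A ((b.coord j).rTensor A (ρ.coact (b i)))

/-- The defining equations of the coefficient elements. -/
lemma coact_basis {ι : Type*} [Fintype ι] (b : Module.Basis ι k V) (i : ι) :
    ρ.coact (b i) = ∑ j, b j ⊗ₜ[k] ρ.coeff b j i := by
  unfold coeff
  generalize ρ.coact (b i) = t
  induction t with
  | zero => simp
  | add x y hx hy => simp only [map_add, TensorProduct.tmul_add, Finset.sum_add_distrib, ← hx, ← hy]
  | tmul x a =>
    simp only [LinearMap.rTensor_tmul, TensorProduct.lid_tmul, Module.Basis.coord_apply,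
      ← TensorProduct.smul_tmul, ← TensorProduct.sum_tmul, b.sum_repr]

/-- The character `∑ i, f i i` of a finite-dimensional comodule (it does not depend on the basis). -/
noncomputable def character [Module.Finite k V] : A :=
  ∑ i, ρ.coeff (Module.finBasis k V) i i

/-- A linear form `s` on `A` acts on `V` by `(1 ⊗ s) ∘ ρ`. -/
noncomputable def dualAct (s : A →ₗ[k] k) : V →ₗ[k] V :=
  TensorProduct.rid k V ∘ₗ s.lTensor V ∘ₗ ρ.coact

/-- The character takes each linear form on `A` to its trace on `V`. -/
lemma apply_character [Module.Finite k V] (s : A →ₗ[k] k) :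
    s ρ.character = LinearMap.trace k V (ρ.dualAct s) := by
  rw [LinearMap.trace_eq_matrix_trace k (Module.finBasis k V), Matrix.trace, character, map_sum]
  refine Finset.sum_congr rfl fun i _ => ?_
  rw [Matrix.diag_apply, LinearMap.toMatrix_apply, dualAct, LinearMap.comp_apply,
    LinearMap.comp_apply, coact_basis ρ (Module.finBasis k V) i]
  simp [Finsupp.single_apply]

end RightComodule

/-- The coalgebra `A` is split: every endomorphism of an irreducible right comodule is a scalar. -/
def IsSplitCoalgebra : Prop :=
  ∀ (V : Type u) [AddCommGroup V] [Module k V] (ρ : RightComodule k A V), ρ.IsIrreducible →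
    ∀ φ : V →ₗ[k] V, ρ.IsEndomorphism φ → ∃ c : k, φ = c • LinearMap.id

/-- `C(A)`, the space of cocommutative elements: those `f` with `T (δ f) = δ f`, for `T` the
twist map of `A ⊗ A`. -/
noncomputable def cocommutativeElements : Submodule k A :=
  LinearMap.eqLocus ((TensorProduct.comm k A A).toLinearMap ∘ₗ Coalgebra.comul) Coalgebra.comul

/-- `C₀(A)`, the span of the characters of the finite-dimensional right comodules. -/
noncomputable def characterSpan : Submodule k A :=
  Submodule.span k {f | ∃ (V : Type u) (_ : AddCommGroup V) (_ : Module k V)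
    (_ : Module.Finite k V) (ρ : RightComodule k A V), f = ρ.character}

/-- The coalgebra `A` is constrained: `C₀(A) = C(A)`. -/
def IsConstrained : Prop :=
  characterSpan k A = cocommutativeElements k A

end Coalgebra

end ConstrainedCoalgebra

/-! Characters are cocommutative because traces satisfy `tr (xy) = tr (yx)`. Conversely, a
cocommutative `a` lies in a finite-dimensional subcoalgebra, hence in a quasi-hereditary one `D`,
and evaluation at `a` is a trace form `τ` on `S = D*`. It remains to write `τ` as a combination of
characters of simple `S`-modules (`IsSplit.exists_eq_sum_trace`).

Let `E` be the dual of the right regular module. It is an injective cogenerator with endomorphism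
ring opposite to `S`, so `τ` is a trace on `End E`. Each `I l` is a summand of a power of `E`, and
`E` is a summand of a finite sum of modules `I l`; hence traces on `End E` correspond to compatible
families of traces `T l` on the rings `End (I l)`.

Such a family is determined by its values at identities (`IsSplit.trace_eq_zero`). By splitness an
endomorphism of `I l` is a scalar on the socle; after subtracting it, the map kills `∇ l`, since `L
l` occurs there only once. The rest of `I l` is filtered by modules `∇ m` with `m > l`, and
injectivity corrects the map, one section at a time, by maps factoring through `I m`, whose traces
vanish by induction.

The trace on `Hom (L l, -)` is another such family, with value `1` at the identity of `I l` and `0`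
at the others, so `T` is a combination of these. On `E` it gives the character of `L l`, because
`Hom (L l, E)` is the linear dual of `L l`. -/

namespace ConstrainedCoalgebra

/-! ### Injective modules as summands of cogenerators -/

section Factorization

variable {S : Type*} [Ring S]

/-- An injective Artinian module is a finite direct sum of direct summands of modules which
cogenerate it. -/
lemma exists_sum_comp_eq_id {M : Type*} [AddCommGroup M] [Module S M] [IsArtinian S M]
    (hM : Module.Baer S M) {ι : Type*} {N : ι → Type*} [∀ i, AddCommGroup (N i)]
    [∀ i, Module S (N i)] (q : ∀ i, M →ₗ[S] N i) (hq : ∀ x, (∀ i, q i x = 0) → x = 0) :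
    ∃ (s : Finset ι) (p : ∀ i, N i →ₗ[S] M), ∑ i ∈ s, p i ∘ₗ q i = LinearMap.id := by
  classical
  -- Choose a finite `s` with minimal common kernel. Adjoining any further index cannot shrink it,
  -- so it lies in every kernel and is zero.
  obtain ⟨_, ⟨s, rfl⟩, hs⟩ := WellFounded.has_min (IsWellFounded.wf (r := (· < ·)))
    (Set.range fun s : Finset ι => s.inf fun i => LinearMap.ker (q i)) ⟨_, ∅, rfl⟩
  have hker : ∀ x, (∀ i ∈ s, q i x = 0) → x = 0 := fun x hx => by
    refine hq x fun j => ?_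
    have h := hs _ ⟨insert j s, rfl⟩
    simp only [Finset.inf_insert] at h
    have h' := (inf_le_right.lt_or_eq.resolve_left h).ge (show x ∈ _ by
      simpa [Submodule.mem_finsetInf] using hx)
    exact h'.1
  -- `M` embeds in the finite product over `s`; the components of a retraction are the maps `p i`,
  -- and the value off `s` is irrelevant.
  obtain ⟨r, hr⟩ := hM.extension_property (LinearMap.pi fun i : s => q i)
    (LinearMap.ker_eq_bot.1 (eq_bot_iff.2 fun x hx => hker x fun i hi =>
      congrFun (LinearMap.mem_ker.1 hx) ⟨i, hi⟩)) LinearMap.id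
  refine ⟨s, fun i => if h : i ∈ s then
    r ∘ₗ LinearMap.single S (fun i : s => N i) ⟨i, h⟩ else 0, LinearMap.ext fun x => ?_⟩
  rw [← hr, LinearMap.sum_apply, ← Finset.sum_attach, LinearMap.comp_apply,
    ← Finset.univ_sum_single (LinearMap.pi (fun i : s => q i) x), map_sum]
  exact Finset.sum_congr rfl fun i _ => by simp

end Factorization

/-! ### Functors `Hom (V, -)` and sums of composites -/

section Postcomp

/-- Used with a decomposition of the identity as the middle sum, to move traces between `E` and the
modules `I l`. -/
lemma map_comp_sum_comp {k S : Type*} [Field k] [Ring S] [Algebra k S] {M N P Q X ι : Type*}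
    [AddCommGroup M] [Module S M] [AddCommGroup N] [Module S N] [AddCommGroup P] [Module S P]
    [AddCommGroup Q] [Module S Q] [Module k Q] [IsScalarTower k S Q] [AddCommGroup X] [Module k X] (t : (M →ₗ[S] Q) →ₗ[k] X)
    (g : P →ₗ[S] Q) (a : ι → N →ₗ[S] P) (f : M →ₗ[S] N) (σ : Finset ι) :
    t (g ∘ₗ (∑ i ∈ σ, a i) ∘ₗ f) = ∑ i ∈ σ, t (g ∘ₗ a i ∘ₗ f) := by
  classical
  induction σ using Finset.induction_on with
  | empty => simp
  | insert i σ hi ih =>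
    rw [Finset.sum_insert hi, Finset.sum_insert hi, LinearMap.add_comp, LinearMap.comp_add,
      map_add, ih]

variable (k : Type*) {S : Type*} [Field k] [Ring S] [Algebra k S]
variable (V : Type*) {M N P : Type*} [AddCommGroup V] [Module S V] [AddCommGroup M] [Module S M]
  [Module k M] [IsScalarTower k S M] [AddCommGroup N] [Module S N] [Module k N]
  [IsScalarTower k S N] [AddCommGroup P] [Module S P] [Module k P] [IsScalarTower k S P]

/-- The functor `Hom_S(V, -)` on morphisms. -/
def postcomp : (M →ₗ[S] N) →ₗ[k] (V →ₗ[S] M) →ₗ[k] (V →ₗ[S] N) :=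
  LinearMap.mk₂ k (fun f g => f ∘ₗ g) (fun _ _ _ => rfl) (fun _ _ _ => rfl)
    (fun f _ _ => LinearMap.ext fun _ => map_add f _ _)
    (fun c f g => LinearMap.ext fun x => LinearMap.map_smul_of_tower f c (g x))

variable {k V}

lemma postcomp_comp (f : N →ₗ[S] P) (g : M →ₗ[S] N) :
    postcomp k V (f ∘ₗ g) = postcomp k V f ∘ₗ postcomp k V g := rfl

lemma postcomp_id : postcomp k V (LinearMap.id : M →ₗ[S] M) = LinearMap.id := rfl

lemma finite_linearMap_of_tower [Module k V] [IsScalarTower k S V] [Module.Finite k V]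
    [Module.Finite k M] : Module.Finite k (V →ₗ[S] M) :=
  let r : (V →ₗ[S] M) →ₗ[k] (V →ₗ[k] M) :=
    { toFun := fun f => f.restrictScalars k
      map_add' := fun _ _ => rfl
      map_smul' := fun _ _ => rfl }
  Module.Finite.of_injective r (LinearMap.restrictScalars_injective k)

end Postcomp

/-! ### The injective cogenerator dual to the regular module -/

section Coregular

variable (k : Type*) (S : Type*) [Field k] [Ring S] [Algebra k S]

/-- The dual of the right regular module of `S`, with left action `(s • φ) x = φ (x * s)`. -/
def Coregular := S →ₗ[k] k

namespace Coregular

instance : AddCommGroup (Coregular k S) := inferInstanceAs (AddCommGroup (S →ₗ[k] k))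

instance : Module k (Coregular k S) := inferInstanceAs (Module k (S →ₗ[k] k))

instance : FunLike (Coregular k S) S k := inferInstanceAs (FunLike (S →ₗ[k] k) S k)

instance : LinearMapClass (Coregular k S) k S k :=
  inferInstanceAs (LinearMapClass (S →ₗ[k] k) k S k)

instance [Module.Finite k S] : Module.Finite k (Coregular k S) :=
  inferInstanceAs (Module.Finite k (S →ₗ[k] k))

variable {k S}

@[ext] lemma ext {φ ψ : Coregular k S} (h : ∀ x, φ x = ψ x) : φ = ψ := DFunLike.ext _ _ h

@[simp] lemma add_apply (φ ψ : Coregular k S) (x : S) : (φ + ψ) x = φ x + ψ x := rfl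

@[simp] lemma zero_apply (x : S) : (0 : Coregular k S) x = 0 := rfl

@[simp] lemma smul_apply (c : k) (φ : Coregular k S) (x : S) : (c • φ) x = c * φ x := rfl

instance : Module S (Coregular k S) where
  smul s φ := (show S →ₗ[k] k from φ) ∘ₗ LinearMap.mulRight k s
  one_smul φ := ext fun x => congrArg φ (mul_one x)
  mul_smul s t φ := ext fun x => congrArg φ (mul_assoc x s t).symm
  smul_zero _ := rfl
  smul_add _ _ _ := rfl
  add_smul s t φ := ext fun x => (congrArg φ (mul_add x s t)).trans (map_add φ _ _)
  zero_smul φ := ext fun x => (congrArg φ (mul_zero x)).trans (map_zero φ)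

@[simp] lemma ring_smul_apply (s : S) (φ : Coregular k S) (x : S) : (s • φ) x = φ (x * s) := rfl

instance : IsScalarTower k S (Coregular k S) :=
  ⟨fun c s φ => ext fun x => by simp⟩

variable (k S) in
/-- Evaluation at `1`. -/
def evalOne : Coregular k S →ₗ[k] k where
  toFun φ := φ 1
  map_add' _ _ := rfl
  map_smul' _ _ := rfl

lemma apply_eq_smul_one (φ : Coregular k S) (s : S) : φ s = (s • φ) 1 := by
  rw [ring_smul_apply, one_mul]

-- An element of the coregular module is known from the values at `1` of its multiples. It therefore
-- suffices to extend the linear form `x ↦ g x 1` from the ideal to `S`, which a linear projection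
-- does.
variable (k S) in
lemma baer : Module.Baer S (Coregular k S) := by
  intro I g
  obtain ⟨r, hr⟩ := LinearMap.exists_leftInverse_of_injective (I.subtype.restrictScalars k)
    (LinearMap.ker_eq_bot.2 I.injective_subtype)
  let φ : Coregular k S := evalOne k S ∘ₗ g.restrictScalars k ∘ₗ r
  refine ⟨LinearMap.toSpanSingleton S (Coregular k S) φ, fun x hx => ext fun y => ?_⟩
  have h : r (y * x) = y • ⟨x, hx⟩ := LinearMap.congr_fun hr (y • ⟨x, hx⟩)
  change g (r (y * x)) 1 = _
  rw [h, map_smul, ← apply_eq_smul_one]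

/-- Linear forms on `V` are module morphisms from `V` to the coregular module. -/
def homEquiv (V : Type*) [AddCommGroup V] [Module S V] [Module k V] [IsScalarTower k S V] :
    Module.Dual k V ≃ₗ[k] (V →ₗ[S] Coregular k S) where
  toFun φ :=
    { toFun := fun x => φ ∘ₗ (LinearMap.toSpanSingleton S V x).restrictScalars k
      map_add' := fun x y => ext fun s => by
        change φ (s • (x + y)) = φ (s • x) + φ (s • y)
        rw [smul_add, map_add]
      map_smul' := fun t x => ext fun s => by
        change φ (s • t • x) = φ ((s * t) • x)
        rw [mul_smul] }
  map_add' _ _ := rfl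
  map_smul' _ _ := rfl
  invFun g :=
    { toFun := fun x => g x 1
      map_add' := fun x y => by rw [map_add, add_apply]
      map_smul' := fun c x => by
        rw [LinearMap.map_smul_of_tower]; rfl }
  left_inv φ := LinearMap.ext fun x => congrArg φ (one_smul S x)
  right_inv g := LinearMap.ext fun x => ext fun s => by
    change g (s • x) 1 = g x s
    rw [map_smul, ring_smul_apply, one_mul]

lemma homEquiv_apply (V : Type*) [AddCommGroup V] [Module S V] [Module k V] [IsScalarTower k S V]
    (φ : Module.Dual k V) (x : V) (s : S) : homEquiv V φ x s = φ (s • x) := rfl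

/-- The endomorphism of the coregular module coming from left multiplication by `s`. -/
def lmulDual (s : S) : Coregular k S →ₗ[S] Coregular k S where
  toFun φ := (show S →ₗ[k] k from φ) ∘ₗ LinearMap.mulLeft k s
  map_add' _ _ := rfl
  map_smul' t φ := ext fun x => congrArg φ (mul_assoc s x t)

@[simp] lemma lmulDual_apply (s : S) (φ : Coregular k S) (x : S) :
    lmulDual s φ x = φ (s * x) := rfl

/-- The form `φ ↦ g φ 1` on the dual of `S` is evaluation at some `s`, by finite dimension;
`S`-linearity then recovers `g` from it. -/
lemma exists_eq_lmulDual [Module.Finite k S] (g : Coregular k S →ₗ[S] Coregular k S) :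
    ∃ s, g = lmulDual s := by
  let ev : Module.Dual k (Module.Dual k S) := evalOne k S ∘ₗ g.restrictScalars k
  refine ⟨(Module.evalEquiv k S).symm ev, LinearMap.ext fun φ => ext fun x => ?_⟩
  have h := Module.apply_evalEquiv_symm_apply (R := k) (M := S) (x • φ : Coregular k S) ev
  rw [apply_eq_smul_one, ← map_smul, lmulDual_apply]
  exact h.symm

/-- The trace on `S`-endomorphisms of the coregular module coming from a linear form on `S`. -/
def endTrace (τ : Coregular k S) : (Coregular k S →ₗ[S] Coregular k S) →ₗ[k] k where
  toFun g := g τ 1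
  map_add' _ _ := rfl
  map_smul' _ _ := rfl

@[simp] lemma endTrace_lmulDual (τ : Coregular k S) (s : S) : endTrace τ (lmulDual s) = τ s :=
  congrArg τ (mul_one s)

lemma endTrace_comm [Module.Finite k S] {τ : Coregular k S} (hτ : ∀ s t, τ (s * t) = τ (t * s))
    (f g : Coregular k S →ₗ[S] Coregular k S) : endTrace τ (f ∘ₗ g) = endTrace τ (g ∘ₗ f) := by
  obtain ⟨s, rfl⟩ := exists_eq_lmulDual f
  obtain ⟨t, rfl⟩ := exists_eq_lmulDual g
  change τ (t * (s * 1)) = τ (s * (t * 1))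
  rw [mul_one, mul_one, hτ]

/-- `homEquiv` identifies `Hom (V, E)` with the dual of `V`, and postcomposition with `lmulDual s`
with the transpose of the action of `s`. -/
lemma trace_postcomp_lmulDual {V : Type*} [AddCommGroup V] [Module S V] [Module k V]
    [IsScalarTower k S V] [Module.Finite k V] (s : S) :
    LinearMap.trace k _ (postcomp k V (lmulDual s : Coregular k S →ₗ[S] Coregular k S)) =
      LinearMap.trace k V (Algebra.lsmul k k V s) := by
  rw [← LinearMap.trace_transpose' (Algebra.lsmul k k V s)]
  refine Eq.trans ?_ (LinearMap.trace_conj' _ (homEquiv (S := S) V))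
  congr 1
  refine LinearMap.ext fun g => ?_
  obtain ⟨φ, rfl⟩ := (homEquiv V).surjective g
  rw [LinearEquiv.conj_apply_apply, LinearEquiv.symm_apply_apply]
  refine LinearMap.ext fun x => ext fun t => ?_
  change φ ((s * t) • x) = φ (s • t • x)
  rw [mul_smul]

end Coregular

end Coregular

/-! ### Traces on the indecomposable injectives of a highest weight category -/

section Extension

variable {S : Type*} [Ring S] {M N Q : Type u} [AddCommGroup M] [Module S M] [AddCommGroup N]
  [Module S N] [AddCommGroup Q] [Module S Q]

/-- A map to an injective module extends along any map whose kernel it kills. -/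
lemma exists_comp_eq_of_ker_le (hQ : Module.Injective S Q) (f : M →ₗ[S] N) (g : M →ₗ[S] Q)
    (h : LinearMap.ker f ≤ LinearMap.ker g) : ∃ e : N →ₗ[S] Q, e ∘ₗ f = g := by
  obtain ⟨e, he⟩ := hQ.out ((LinearMap.ker f).liftQ f le_rfl)
    (LinearMap.ker_eq_bot.1 (Submodule.ker_liftQ_eq_bot _ _ _ le_rfl)) ((LinearMap.ker f).liftQ g h)
  exact ⟨e, LinearMap.ext fun x => he (Submodule.Quotient.mk x)⟩

lemma isAtom_range_of_injective [IsSimpleModule S M] {f : M →ₗ[S] N} (hf : Function.Injective f) :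
    IsAtom (LinearMap.range f) :=
  isSimpleModule_iff_isAtom.1 (IsSimpleModule.congr (LinearEquiv.ofInjective f hf).symm)

end Extension

namespace HighestWeightStructure

variable {S : Type w} [Ring S] {Λ : Type} [PartialOrder Λ] (H : HighestWeightStructure.{u, w} S Λ)

/-- A simple module which maps nontrivially to `I l` is isomorphic to `L l`, with image the socle. -/
lemma range_eq_of_ne_zero {l : Λ} {V : Type u} [AddCommGroup V] [Module S V] [IsSimpleModule S V]
    {g : V →ₗ[S] H.I l} (hg : g ≠ 0) :
    Function.Injective g ∧ LinearMap.range g = LinearMap.range (H.j l) := by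
  have := H.simple l
  have hinj := g.injective_or_eq_zero.resolve_right hg
  refine ⟨hinj, ?_⟩
  have h1 := isAtom_range_of_injective hinj
  have h2 := isAtom_range_of_injective (H.envelope l).injective
  by_contra hne
  exact (H.envelope l).essential _ h1.1 (h1.disjoint_of_ne h2 hne).eq_bot

lemma eq_zero_of_ne {l m : Λ} (hlm : l ≠ m) (g : H.L l →ₗ[S] H.I m) : g = 0 := by
  by_contra hg
  have := H.simple l
  obtain ⟨hinj, hr⟩ := H.range_eq_of_ne_zero hg
  exact hlm (H.eq_of_iso l m ⟨(LinearEquiv.ofInjective g hinj).trans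
    ((LinearEquiv.ofEq _ _ hr).trans (LinearEquiv.ofInjective _ (H.envelope m).injective).symm)⟩)

/-- An endomorphism of `I l` which kills the socle kills `∇ l`. -/
lemma nabla_le_ker {l : Λ} (f : H.I l →ₗ[S] H.I l) (hf : f ∘ₗ H.j l = 0) :
    H.nabla l ≤ LinearMap.ker f := by
  have := H.simple l
  have hj : LinearMap.range (H.j l) ≤ LinearMap.ker f := LinearMap.range_le_ker_iff.2 hf
  obtain ⟨hle, hfac⟩ := (H.nabla_isGreatest l).1
  by_contra hN
  have hne : (H.nabla l).map f ≠ ⊥ := fun h => hN (Submodule.map_le_iff_le_comap.1 h.le)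
  have hatom := isAtom_range_of_injective (H.envelope l).injective
  have hle' : LinearMap.range (H.j l) ≤ (H.nabla l).map f := by
    by_contra h
    exact (H.envelope l).essential _ hne ((hatom.not_le_iff_disjoint.1 h).symm.eq_bot)
  -- By essentiality the image of `∇ l`, if nonzero, contains the socle. Then `U / W` is a factor of
  -- `∇ l` above the socle isomorphic to `L l`, whereas only `L m` with `m < l` are allowed.
  set U := H.nabla l ⊓ (LinearMap.range (H.j l)).comap f
  set W := H.nabla l ⊓ LinearMap.ker f
  have hWU : W ≤ U := inf_le_inf_left _ fun x hx => by
    rw [Submodule.mem_comap, LinearMap.mem_ker.1 hx]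
    exact zero_mem _
  let g : U →ₗ[S] LinearMap.range (H.j l) :=
    (f ∘ₗ U.subtype).codRestrict _ fun x => x.2.2
  have hg : Function.Surjective g := fun y => by
    obtain ⟨x, hx, hxy⟩ := hle' y.2
    refine ⟨⟨x, hx, ?_⟩, Subtype.ext hxy⟩
    rw [SetLike.mem_coe, Submodule.mem_comap, hxy]
    exact y.2
  have hker : W.submoduleOf U = LinearMap.ker g := by
    ext x
    exact ⟨fun h => Subtype.ext h.2, fun h => ⟨x.2.1, congrArg Subtype.val h⟩⟩
  let e : (U ⧸ W.submoduleOf U) ≃ₗ[S] H.L l :=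
    (Submodule.quotEquivOfEq _ _ hker).trans ((g.quotKerEquivOfSurjective hg).trans
      (LinearEquiv.ofInjective _ (H.envelope l).injective).symm)
  have hcov : W ⋖ U := (covBy_iff_quot_is_simple hWU).2 (IsSimpleModule.congr e)
  obtain ⟨m, hm, ⟨e'⟩⟩ := hfac W U (le_inf hle hj) hcov inf_le_left
  exact (Set.mem_Iio.1 hm).ne (H.eq_of_iso _ _ ⟨e'.symm.trans e⟩)

section Trace

variable {k : Type*} [Field k] [Algebra k S] [∀ l, Module k (H.I l)]
  [∀ l, IsScalarTower k S (H.I l)]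

/-- The endomorphisms of the simple modules are scalars. -/
def IsSplit (k : Type*) [Field k] [Algebra k S] : Prop :=
  ∀ (l : Λ) (f : H.L l →ₗ[S] H.L l), ∃ c : k, ∀ x, f x = algebraMap k S c • x

variable {H} in
lemma IsSplit.exists_smul (hH : H.IsSplit k) {l : Λ} (g : H.L l →ₗ[S] H.I l) :
    ∃ c : k, g = c • H.j l := by
  have := H.simple l
  by_cases hg : g = 0
  · exact ⟨0, by rw [hg, zero_smul]⟩
  obtain ⟨-, hr⟩ := H.range_eq_of_ne_zero hg
  let e := LinearEquiv.ofInjective _ (H.envelope l).injective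
  let f : H.L l →ₗ[S] H.L l :=
    e.symm.toLinearMap ∘ₗ g.codRestrict _ fun x => hr.le (LinearMap.mem_range_self g x)
  obtain ⟨c, hc⟩ := hH l f
  refine ⟨c, LinearMap.ext fun x => ?_⟩
  have h : H.j l (f x) = g x := congrArg Subtype.val (e.apply_symm_apply _)
  rw [← h, hc, map_smul, algebraMap_smul, LinearMap.smul_apply]

variable {H} in
/-- A trace on the endomorphisms of the indecomposable injective modules is determined by its
values at the identity maps. -/
lemma IsSplit.trace_eq_zero [Finite Λ] (hH : H.IsSplit k)
    (T : ∀ l, (H.I l →ₗ[S] H.I l) →ₗ[k] k)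
    (hT : ∀ l m (f : H.I l →ₗ[S] H.I m) (g : H.I m →ₗ[S] H.I l), T l (g ∘ₗ f) = T m (f ∘ₗ g))
    (hid : ∀ l, T l LinearMap.id = 0) (l : Λ) (f : H.I l →ₗ[S] H.I l) : T l f = 0 := by
  -- Downward induction on weights: the sections above `∇ l` have labels larger than `l`.
  induction l using (Finite.to_wellFoundedGT (α := Λ)).wf.induction with
  | _ l ih =>
  obtain ⟨c, hc⟩ := hH.exists_smul (f ∘ₗ H.j l)
  obtain ⟨n, F, h0, hn, hF⟩ := H.filtration l
  -- Here `d` counts the filtration sections not yet known to be killed by `g`.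
  have key : ∀ d ≤ n, ∀ g : H.I l →ₗ[S] H.I l, F (n - d) ≤ LinearMap.ker g → T l g = 0 := by
    intro d
    induction d with
    | zero =>
      intro _ g hg
      rw [Nat.sub_zero, hn, top_le_iff, LinearMap.ker_eq_top] at hg
      rw [hg, map_zero]
    | succ d ihd =>
      intro hd g hg
      obtain ⟨hle, m, hm, ⟨e⟩⟩ := hF (n - (d + 1)) (by omega)
      rw [show n - (d + 1) + 1 = n - d by omega] at hle e
      set A := F (n - (d + 1))
      set B := F (n - d)
      let q : B →ₗ[S] H.I m :=
        (H.nabla m).subtype ∘ₗ e.toLinearMap ∘ₗ (A.submoduleOf B).mkQ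
      have hq : ∀ x, q x = 0 → (x : H.I l) ∈ A := fun x hx => by
        have := e.map_eq_zero_iff.1 (Subtype.ext hx)
        exact (Submodule.Quotient.mk_eq_zero (A.submoduleOf B)).1 this
      -- On `B` the map `g` factors through the section, embedded in `I m` by `q`. Extending both
      -- factors by injectivity gives `r ∘ₗ q'`, which agrees with `g` on `B` and has the trace of
      -- the endomorphism `q' ∘ₗ r` of `I m`.
      obtain ⟨q', hq'⟩ := exists_comp_eq_of_ker_le (H.envelope m).injective_module B.subtype q
        (by rw [Submodule.ker_subtype]; exact bot_le)
      obtain ⟨r, hr⟩ := exists_comp_eq_of_ker_le (H.envelope l).injective_module q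
        (g ∘ₗ B.subtype) fun x hx => hg (hq x hx)
      have h1 : T l (g - r ∘ₗ q') = 0 := ihd (by omega) _ fun x hx => by
        have h2 : q' x = q ⟨x, hx⟩ := LinearMap.congr_fun hq' ⟨x, hx⟩
        have h3 : r (q ⟨x, hx⟩) = g x := LinearMap.congr_fun hr ⟨x, hx⟩
        rw [LinearMap.mem_ker, LinearMap.sub_apply, LinearMap.comp_apply, h2, h3, sub_self]
      rw [map_sub, hT, ih m hm, sub_zero] at h1
      exact h1
  have h := key n le_rfl (f - c • LinearMap.id) (by
    rw [Nat.sub_self, h0]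
    refine H.nabla_le_ker _ ?_
    rw [LinearMap.sub_comp, hc, LinearMap.smul_comp, LinearMap.id_comp, sub_self])
  rwa [map_sub, map_smul, hid, smul_zero, sub_zero] at h

/-- The indecomposable injective modules cogenerate. -/
lemma exists_apply_ne_zero [Small.{u} S] {M : Type*} [AddCommGroup M]
    [Module S M] [IsArtinian S M] {x : M} (hx : x ≠ 0) :
    ∃ (l : Λ) (q : M →ₗ[S] H.I l), q x ≠ 0 := by
  have : IsAtomic (Submodule S M) := isAtomic_of_orderBot_wellFounded_lt wellFounded_lt
  obtain ⟨V, hV, hVx⟩ := (eq_bot_or_exists_atom_le (S ∙ x)).resolve_left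
    (mt Submodule.span_singleton_eq_bot.1 hx)
  have hVs : IsSimpleModule S V := isSimpleModule_iff_isAtom.2 hV
  have := IsSimpleModule.nontrivial S V
  obtain ⟨v, hv⟩ := exists_ne (0 : V)
  -- `V` is a quotient of `S`, so it has a copy in the universe where `H.complete` applies.
  have : Small.{u} V := small_of_surjective (IsSimpleModule.toSpanSingleton_surjective S hv)
  obtain ⟨l, ⟨e⟩⟩ := H.complete (ModuleCat.of S (Shrink.{u} V))
    (IsSimpleModule.congr (Shrink.linearEquiv S V))
  let i : V →ₗ[S] H.I l := H.j l ∘ₗ e.toLinearMap ∘ₗ (Shrink.linearEquiv S V).symm.toLinearMap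
  have hi : Function.Injective i :=
    (H.envelope l).injective.comp (e.injective.comp (Shrink.linearEquiv S V).symm.injective)
  have := (H.envelope l).injective_module
  obtain ⟨q, hq⟩ := Module.Injective.extension_property S (H.I l) _ _ V.subtype
    V.injective_subtype i
  refine ⟨l, q, fun h => hv (hi ?_)⟩
  obtain ⟨s, hs⟩ := Submodule.mem_span_singleton.1 (hVx v.2)
  rw [map_zero, ← hq, LinearMap.comp_apply, Submodule.subtype_apply, ← hs, map_smul, h, smul_zero]

end Trace

section TraceForm

variable {k : Type u} [Field k] [Algebra k S] [∀ l, Module k (H.I l)]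
  [∀ l, IsScalarTower k S (H.I l)] [∀ l, Module k (H.L l)] [∀ l, IsScalarTower k S (H.L l)]

variable {H} in
/-- On the socle functors, the traces take the values `0` and `1` at identity maps. -/
lemma IsSplit.trace_id [Module.Finite k S] (hH : H.IsSplit k) (l m : Λ) [Decidable (l = m)] :
    LinearMap.trace k (H.L l →ₗ[S] H.I m) LinearMap.id = if l = m then 1 else 0 := by
  split_ifs with h
  · subst h
    have := H.simple l
    have := IsSimpleModule.nontrivial S (H.L l)
    have := H.finite_I l
    have : Module.Finite k (H.L l) := Module.Finite.trans S _
    have : Module.Finite k (H.I l) := Module.Finite.trans S _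
    have : Module.Finite k (H.L l →ₗ[S] H.I l) := finite_linearMap_of_tower
    have hj : H.j l ≠ 0 := fun h => by
      obtain ⟨x, hx⟩ := exists_ne (0 : H.L l)
      exact hx ((H.envelope l).injective (by rw [h, LinearMap.zero_apply, map_zero]))
    rw [LinearMap.trace_id, finrank_eq_one (H.j l) hj fun g => (hH.exists_smul g).imp
      fun c hc => hc.symm, Nat.cast_one]
  · have : LinearMap.id = (0 : (H.L l →ₗ[S] H.I m) →ₗ[k] (H.L l →ₗ[S] H.I m)) :=
      LinearMap.ext fun g => H.eq_zero_of_ne h g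
    rw [this, map_zero]

variable {H} in
/-- Over a split quasi-hereditary algebra every trace form is a combination of the characters of
the simple modules. -/
theorem IsSplit.exists_eq_sum_trace [Fintype Λ] [Module.Finite k S] (hH : H.IsSplit k)
    (τ : S →ₗ[k] k) (hτ : ∀ s t, τ (s * t) = τ (t * s)) :
    ∃ c : Λ → k, ∀ s, τ s = ∑ l, c l * LinearMap.trace k (H.L l) (Algebra.lsmul k k (H.L l) s) := by
  classical
  have : Small.{u} S := Module.Finite.small k S
  have hfinI : ∀ l, Module.Finite k (H.I l) := fun l =>
    have := H.finite_I l
    Module.Finite.trans S _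
  have hfinL : ∀ l, Module.Finite k (H.L l) := fun l =>
    have := H.simple l
    Module.Finite.trans S _
  have hfinLI : ∀ l m, Module.Finite k (H.L l →ₗ[S] H.I m) := fun _ _ => finite_linearMap_of_tower
  have hfinLE : ∀ l, Module.Finite k (H.L l →ₗ[S] Coregular k S) :=
    fun _ => finite_linearMap_of_tower
  have hartI : ∀ l, IsArtinian S (H.I l) := fun l => isArtinian_of_tower k inferInstance
  have hartE : IsArtinian S (Coregular k S) := isArtinian_of_tower k inferInstance
  let t := Coregular.endTrace (show Coregular k S from τ)
  have ht : ∀ f g, t (f ∘ₗ g) = t (g ∘ₗ f) := Coregular.endTrace_comm hτ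
  have hI : ∀ l, ∃ (σ : Finset (Module.Dual k (H.I l)))
      (q : Module.Dual k (H.I l) → H.I l →ₗ[S] Coregular k S)
      (p : Module.Dual k (H.I l) → Coregular k S →ₗ[S] H.I l),
      ∑ i ∈ σ, p i ∘ₗ q i = LinearMap.id := fun l => by
    obtain ⟨σ, p, hp⟩ := exists_sum_comp_eq_id
      (Module.Baer.of_injective (H.envelope l).injective_module)
      (fun φ => Coregular.homEquiv (S := S) (k := k) (H.I l) φ) fun x hx =>
        (Module.forall_dual_apply_eq_zero_iff k x).1 fun φ => by
          have := DFunLike.congr_fun (hx φ) 1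
          rwa [Coregular.homEquiv_apply, one_smul] at this
    exact ⟨σ, _, p, hp⟩
  choose σ q p hpq using hI
  -- The trace `t` transported to `I l` as a summand of a power of `E`; `hTt` shows that it is
  -- compatible with maps between `E` and `I l`.
  let T : ∀ l, (H.I l →ₗ[S] H.I l) →ₗ[k] k := fun l =>
    { toFun := fun f => ∑ i ∈ σ l, t (q l i ∘ₗ f ∘ₗ p l i)
      map_add' := fun f g => by
        simp only [LinearMap.add_comp, LinearMap.comp_add, map_add, Finset.sum_add_distrib]
      map_smul' := fun c f => by
        rw [RingHom.id_apply, Finset.smul_sum]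
        exact Finset.sum_congr rfl fun i _ => by
          rw [← map_smul, LinearMap.smul_comp]
          exact congrArg t (LinearMap.ext fun x => LinearMap.map_smul_of_tower _ c _) }
  have hTt : ∀ l (f : Coregular k S →ₗ[S] H.I l) (g : H.I l →ₗ[S] Coregular k S),
      T l (f ∘ₗ g) = t (g ∘ₗ f) := fun l f g => by
    calc T l (f ∘ₗ g) = ∑ i ∈ σ l, t ((q l i ∘ₗ f) ∘ₗ (g ∘ₗ p l i)) := rfl
      _ = ∑ i ∈ σ l, t (g ∘ₗ (p l i ∘ₗ q l i) ∘ₗ f) := Finset.sum_congr rfl fun i _ => ht _ _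
      _ = t (g ∘ₗ (∑ i ∈ σ l, p l i ∘ₗ q l i) ∘ₗ f) := (map_comp_sum_comp _ _ _ _ _).symm
      _ = t (g ∘ₗ f) := by rw [hpq, LinearMap.id_comp]
  have hT : ∀ l m (f : H.I l →ₗ[S] H.I m) (g : H.I m →ₗ[S] H.I l),
      T l (g ∘ₗ f) = T m (f ∘ₗ g) := fun l m f g => by
    calc T l (g ∘ₗ f) = ∑ i ∈ σ l, t ((q l i ∘ₗ g) ∘ₗ (f ∘ₗ p l i)) := rfl
      _ = ∑ i ∈ σ l, T m (f ∘ₗ (p l i ∘ₗ q l i) ∘ₗ g) := Finset.sum_congr rfl fun i _ =>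
        (hTt m (f ∘ₗ p l i) (q l i ∘ₗ g)).symm
      _ = T m (f ∘ₗ (∑ i ∈ σ l, p l i ∘ₗ q l i) ∘ₗ g) := (map_comp_sum_comp _ _ _ _ _).symm
      _ = T m (f ∘ₗ g) := by rw [hpq, LinearMap.id_comp]
  let χ : ∀ l m, (H.I m →ₗ[S] H.I m) →ₗ[k] k := fun l m =>
    LinearMap.trace k _ ∘ₗ postcomp k (H.L l)
  have hTχ : ∀ m (f : H.I m →ₗ[S] H.I m), T m f = ∑ l, T l LinearMap.id * χ l m f := by
    intro m f
    have h := hH.trace_eq_zero (fun m => T m - ∑ l, T l LinearMap.id • χ l m)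
      (fun l m f g => by
        simp only [LinearMap.sub_apply, LinearMap.sum_apply, LinearMap.smul_apply, hT l m f g, χ,
          LinearMap.comp_apply, postcomp_comp, LinearMap.trace_comp_comm' (postcomp k _ f)])
      (fun m => by
        simp only [LinearMap.sub_apply, LinearMap.sum_apply, LinearMap.smul_apply, χ,
          LinearMap.comp_apply, postcomp_id, hH.trace_id, smul_eq_mul, mul_ite, mul_one, mul_zero,
          Finset.sum_ite_eq', Finset.mem_univ, if_true, sub_self]) m f
    simpa [sub_eq_zero] using h
  -- Conversely, `E` is a summand of a finite sum of modules `I l`, which brings the formula `hTχ`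
  -- back to `E`.
  obtain ⟨ρ, b, hb⟩ := exists_sum_comp_eq_id (Coregular.baer k S)
    (fun a : Σ l, (Coregular k S →ₗ[S] H.I l) => a.2) fun x hx => by
      by_contra hne
      obtain ⟨l, a, ha⟩ := H.exists_apply_ne_zero hne
      exact ha (hx ⟨l, a⟩)
  refine ⟨fun l => T l LinearMap.id, fun s => ?_⟩
  have hχ : ∀ l, ∀ a : Σ l, (Coregular k S →ₗ[S] H.I l),
      χ l a.1 (a.2 ∘ₗ Coregular.lmulDual s ∘ₗ b a) =
        LinearMap.trace k (H.L l →ₗ[S] Coregular k S)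
          (postcomp k _ (Coregular.lmulDual s ∘ₗ (b a ∘ₗ a.2) ∘ₗ LinearMap.id)) := fun l a => by
    simp only [χ, LinearMap.comp_apply, postcomp_comp a.2]
    rw [LinearMap.trace_comp_comm']
    rfl
  calc τ s = t (Coregular.lmulDual s) := (Coregular.endTrace_lmulDual _ s).symm
    _ = t (Coregular.lmulDual s ∘ₗ (∑ a ∈ ρ, b a ∘ₗ a.2) ∘ₗ LinearMap.id) := by
      rw [hb, LinearMap.comp_id, LinearMap.comp_id]
    _ = ∑ a ∈ ρ, T a.1 (a.2 ∘ₗ Coregular.lmulDual s ∘ₗ b a) :=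
      (map_comp_sum_comp _ _ _ _ _).trans (Finset.sum_congr rfl fun a _ =>
        (hTt a.1 a.2 (Coregular.lmulDual s ∘ₗ b a)).symm ▸ rfl)
    _ = ∑ l, T l LinearMap.id * ∑ a ∈ ρ, χ l a.1 (a.2 ∘ₗ Coregular.lmulDual s ∘ₗ b a) := by
      simp only [hTχ _ (_ ∘ₗ _ ∘ₗ _), Finset.mul_sum]
      exact Finset.sum_comm
    _ = _ := Finset.sum_congr rfl fun l _ => by
      rw [Finset.sum_congr rfl fun a _ => hχ l a, ← Coregular.trace_postcomp_lmulDual]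
      have h := map_comp_sum_comp (LinearMap.trace k _ ∘ₗ postcomp k (H.L l))
        (Coregular.lmulDual (k := k) s) (fun a => b a ∘ₗ a.2) LinearMap.id ρ
      rw [hb, LinearMap.comp_id, LinearMap.comp_id] at h
      exact congrArg _ h.symm

end TraceForm

end HighestWeightStructure

/-! ### Contraction of tensors by linear forms -/

section Contraction

variable {k : Type*} [Field k] {V A : Type*} [AddCommGroup V] [Module k V] [AddCommGroup A]
  [Module k A]

/-- The contraction of `V ⊗ A` by a linear form on the right factor. -/
noncomputable def contractRight (V : Type*) [AddCommGroup V] [Module k V] (s : A →ₗ[k] k) :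
    V ⊗[k] A →ₗ[k] V :=
  TensorProduct.rid k V ∘ₗ s.lTensor V

@[simp] lemma contractRight_tmul (s : A →ₗ[k] k) (v : V) (a : A) :
    contractRight V s (v ⊗ₜ a) = s a • v := by
  simp [contractRight]

lemma contractRight_ext {x y : V ⊗[k] A} (h : ∀ s, contractRight V s x = contractRight V s y) :
    x = y := by
  classical
  let b := Module.Basis.ofVectorSpace k A
  refine (TensorProduct.equivFinsuppOfBasisRight (M := V) b).injective (Finsupp.ext fun i => ?_)
  have key : ∀ z : V ⊗[k] A, TensorProduct.equivFinsuppOfBasisRight b z i =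
      contractRight V (b.coord i) z := fun z => by
    induction z with
    | zero => simp
    | add x y hx hy => simp [hx, hy]
    | tmul v a => simp
  rw [key, key, h]

lemma contractRight_rTensor {W : Type*} [AddCommGroup W] [Module k W] (f : V →ₗ[k] W)
    (s : A →ₗ[k] k) (x : V ⊗[k] A) :
    contractRight W s (f.rTensor A x) = f (contractRight V s x) := by
  induction x with
  | zero => simp
  | add x y hx hy => simp [hx, hy]
  | tmul v a => simp

lemma contractRight_mem {W : Submodule k V} {x : V ⊗[k] A}
    (hx : x ∈ LinearMap.range (W.subtype.rTensor A)) (s : A →ₗ[k] k) :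
    contractRight V s x ∈ W := by
  obtain ⟨y, rfl⟩ := hx
  rw [contractRight_rTensor]
  exact Subtype.property _

lemma map_eq_contractRight (s t : A →ₗ[k] k) (x : A ⊗[k] A) :
    LinearMap.mul' k k (TensorProduct.map s t x) = s (contractRight A t x) := by
  induction x with
  | zero => simp
  | add x y hx hy => simp only [map_add, hx, hy]
  | tmul a b => simp [mul_comm]

lemma contractRight_contractRight (s t : A →ₗ[k] k) (x : (V ⊗[k] A) ⊗[k] A) :
    contractRight V s (contractRight (V ⊗[k] A) t x) =
      contractRight V (LinearMap.mul' k k ∘ₗ TensorProduct.map s t)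
        (TensorProduct.assoc k V A A x) := by
  induction x with
  | zero => simp
  | add x y hx hy => simp only [map_add, hx, hy]
  | tmul x b =>
    induction x with
    | zero => simp
    | add x y hx hy => simp only [map_add, TensorProduct.add_tmul, hx, hy]
    | tmul v a => simp [smul_smul, mul_comm]

lemma contractRight_lTensor {B : Type*} [AddCommGroup B] [Module k B] (f : A →ₗ[k] B)
    (s : B →ₗ[k] k) (x : V ⊗[k] A) :
    contractRight V s (f.lTensor V x) = contractRight V (s ∘ₗ f) x := by
  induction x with
  | zero => simp
  | add x y hx hy => simp [hx, hy]
  | tmul v a => simp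

/-- Linear forms separate the elements of a vector space. -/
lemma ext_dual {a b : A} (h : ∀ s : A →ₗ[k] k, s a = s b) : a = b := by
  rw [← sub_eq_zero, ← Module.forall_dual_apply_eq_zero_iff k]
  intro s
  rw [map_sub, h, sub_self]

/-- Contracting the two outer factors leaves combinations of the finitely many middle factors of
`x`. -/
lemma exists_finite_contraction_mem (x : (A ⊗[k] A) ⊗[k] A) :
    ∃ W : Submodule k A, Module.Finite k W ∧ ∀ s t : A →ₗ[k] k, contractRight A s
      (TensorProduct.comm k A A (contractRight (A ⊗[k] A) t x)) ∈ W := by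
  induction x with
  | zero => exact ⟨⊥, inferInstance, fun s t => by simp⟩
  | add x y hx hy =>
    obtain ⟨W, _, hW⟩ := hx
    obtain ⟨W', _, hW'⟩ := hy
    refine ⟨W ⊔ W', inferInstance, fun s t => ?_⟩
    simp only [map_add]
    exact Submodule.add_mem_sup (hW s t) (hW' s t)
  | tmul x c =>
    induction x with
    | zero => exact ⟨⊥, inferInstance, fun s t => by simp⟩
    | add x y hx hy =>
      obtain ⟨W, _, hW⟩ := hx
      obtain ⟨W', _, hW'⟩ := hy
      refine ⟨W ⊔ W', inferInstance, fun s t => ?_⟩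
      simp only [map_add, TensorProduct.add_tmul]
      exact Submodule.add_mem_sup (hW s t) (hW' s t)
    | tmul a b =>
      refine ⟨k ∙ b, inferInstance, fun s t => ?_⟩
      simp only [contractRight_tmul, map_smul, TensorProduct.comm_tmul]
      exact Submodule.smul_mem _ _ (Submodule.smul_mem _ _ (Submodule.mem_span_singleton_self b))

end Contraction

/-! ### The dual algebra, its trace forms and its action on comodules -/

section Convolution

variable {k : Type*} [Field k] {A : Type*} [AddCommGroup A] [Module k A] [Coalgebra k A]

/-- The convolution product of linear forms on a coalgebra. -/
noncomputable def conv (s t : A →ₗ[k] k) : A →ₗ[k] k :=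
  (WithConv.toConv s * WithConv.toConv t).ofConv

lemma conv_assoc (r s t : A →ₗ[k] k) : conv (conv r s) t = conv r (conv s t) :=
  congrArg WithConv.ofConv (mul_assoc (WithConv.toConv r) (WithConv.toConv s) (WithConv.toConv t))

lemma conv_apply (s t : A →ₗ[k] k) (a : A) :
    conv s t a = s (contractRight A t (Coalgebra.comul a)) :=
  map_eq_contractRight s t _

lemma conv_apply' (s t : A →ₗ[k] k) (a : A) :
    conv s t a = t (contractRight A s (TensorProduct.comm k A A (Coalgebra.comul a))) := by
  refine Eq.trans ?_ (map_eq_contractRight t s _)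
  change LinearMap.mul' k k (TensorProduct.map _ _ (Coalgebra.comul a)) = _
  generalize (Coalgebra.comul a : A ⊗[k] A) = x
  induction x with
  | zero => simp
  | add x y hx hy => simp only [map_add, hx, hy]
  | tmul x y => simp [mul_comm]

/-- Pairs of linear forms separate `A ⊗ A`, so cocommutative elements are those at which evaluation
is a trace form on the dual algebra. -/
lemma mem_cocommutativeElements_iff {a : A} :
    a ∈ cocommutativeElements k A ↔ ∀ s t : A →ₗ[k] k, conv s t a = conv t s a := by
  change TensorProduct.comm k A A (Coalgebra.comul a) = Coalgebra.comul a ↔ _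
  refine ⟨fun h s t => by rw [conv_apply', h, ← conv_apply], fun h => ?_⟩
  refine contractRight_ext fun t => ?_
  exact ext_dual (k := k) fun s => by rw [← conv_apply', ← conv_apply, h]

end Convolution

namespace RightComodule

variable {k : Type u} {A : Type v} [Field k] [AddCommGroup A] [Module k A] [Coalgebra k A]
  {V : Type u} [AddCommGroup V] [Module k V]

lemma dualAct_conv (ρ : RightComodule k A V) (s t : A →ₗ[k] k) :
    ρ.dualAct (conv s t) = ρ.dualAct s ∘ₗ ρ.dualAct t := by
  refine LinearMap.ext fun x => ?_
  have h := congrArg (contractRight V (LinearMap.mul' k k ∘ₗ TensorProduct.map s t))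
    (LinearMap.congr_fun ρ.coassoc x)
  simp only [LinearMap.comp_apply, LinearEquiv.coe_coe] at h
  rw [← contractRight_contractRight, contractRight_rTensor, contractRight_lTensor] at h
  exact h.symm

lemma character_mem_cocommutativeElements (ρ : RightComodule k A V) [Module.Finite k V] :
    ρ.character ∈ cocommutativeElements k A :=
  mem_cocommutativeElements_iff.2 fun s t => by
    rw [apply_character, apply_character, dualAct_conv, dualAct_conv, LinearMap.trace_comp_comm']

/-- A comodule structure is the same as an action of the dual algebra through contractions. -/
noncomputable def ofContraction (ρ : V →ₗ[k] V ⊗[k] A)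
    (hmul : ∀ (s t : A →ₗ[k] k) x, contractRight V (conv s t) (ρ x) =
      contractRight V s (ρ (contractRight V t (ρ x))))
    (hone : ∀ x, contractRight V Coalgebra.counit (ρ x) = x) : RightComodule k A V where
  coact := ρ
  coassoc := by
    refine LinearMap.ext fun x => (TensorProduct.assoc k V A A).symm.injective ?_
    refine contractRight_ext fun t => contractRight_ext fun s => ?_
    rw [contractRight_contractRight, contractRight_contractRight]
    simp only [LinearMap.comp_apply, LinearEquiv.coe_coe, LinearEquiv.apply_symm_apply]
    rw [← contractRight_contractRight, contractRight_rTensor, contractRight_lTensor]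
    exact (hmul s t x).symm
  counit := LinearMap.ext hone

end RightComodule

/-! ### Local finiteness of coalgebras -/

section LocalFiniteness

variable {k : Type u} {A : Type v} [Field k] [AddCommGroup A] [Module k A] [Coalgebra k A]

/-- The left action of a linear form on the coalgebra. -/
noncomputable def leftHit (s : A →ₗ[k] k) : A →ₗ[k] A :=
  contractRight A s ∘ₗ Coalgebra.comul

/-- The right action of a linear form on the coalgebra. -/
noncomputable def rightHit (s : A →ₗ[k] k) : A →ₗ[k] A :=
  contractRight A s ∘ₗ (TensorProduct.comm k A A).toLinearMap ∘ₗ Coalgebra.comul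

lemma apply_leftHit (s t : A →ₗ[k] k) (a : A) : s (leftHit t a) = conv s t a :=
  (conv_apply s t a).symm

lemma apply_rightHit (s t : A →ₗ[k] k) (a : A) : t (rightHit s a) = conv s t a :=
  (conv_apply' s t a).symm

lemma leftHit_leftHit (s t : A →ₗ[k] k) (a : A) :
    leftHit s (leftHit t a) = leftHit (conv s t) a :=
  ext_dual (k := k) fun r => by simp only [apply_leftHit, conv_assoc]

lemma rightHit_rightHit (s t : A →ₗ[k] k) (a : A) :
    rightHit s (rightHit t a) = rightHit (conv t s) a :=
  ext_dual (k := k) fun r => by simp only [apply_rightHit, conv_assoc]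

lemma leftHit_rightHit (s t : A →ₗ[k] k) (a : A) :
    leftHit s (rightHit t a) = rightHit t (leftHit s a) :=
  ext_dual (k := k) fun r => by simp only [apply_rightHit, apply_leftHit, conv_assoc]

lemma leftHit_counit (a : A) : leftHit (Coalgebra.counit (R := k)) a = a := by
  rw [leftHit, LinearMap.comp_apply, contractRight, LinearMap.comp_apply,
    Coalgebra.lTensor_counit_comul]
  simp

lemma rightHit_counit (a : A) : rightHit (Coalgebra.counit (R := k)) a = a :=
  ext_dual (k := k) fun s => by
    have h : WithConv.toConv Coalgebra.counit = (1 : WithConv (A →ₗ[k] k)) := rfl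
    rw [apply_rightHit, conv, h, one_mul]

/-- A projection onto `X` fixes `δ a` when applied to the left factor, by `hl`, and to the right
factor, by `hr`; applying both places `δ a` in `X ⊗ X`. -/
lemma comul_mem_range_of_hit_mem {X : Submodule k A} {a : A} (hl : ∀ s : A →ₗ[k] k, leftHit s a ∈ X)
    (hr : ∀ s : A →ₗ[k] k, rightHit s a ∈ X) :
    Coalgebra.comul a ∈ LinearMap.range (TensorProduct.map X.subtype X.subtype) := by
  obtain ⟨p, hp⟩ := LinearMap.exists_leftInverse_of_injective X.subtype
    (LinearMap.ker_eq_bot.2 X.injective_subtype)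
  have hπ : ∀ x ∈ X, (X.subtype ∘ₗ p) x = x := fun x hx =>
    congrArg Subtype.val (LinearMap.congr_fun hp ⟨x, hx⟩)
  have h1 : (X.subtype ∘ₗ p).rTensor A (Coalgebra.comul a) = Coalgebra.comul (R := k) a :=
    contractRight_ext fun s => by
      rw [contractRight_rTensor]
      exact hπ _ (hl s)
  have h2 : (X.subtype ∘ₗ p).rTensor A (TensorProduct.comm k A A (Coalgebra.comul a)) =
      TensorProduct.comm k A A (Coalgebra.comul (R := k) a) :=
    contractRight_ext fun s => by
      rw [contractRight_rTensor]
      exact hπ _ (hr s)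
  rw [← LinearMap.comm_comp_lTensor_comp_comm_eq] at h2
  simp only [LinearMap.comp_apply, LinearEquiv.coe_coe, TensorProduct.comm_comm,
    EmbeddingLike.apply_eq_iff_eq] at h2
  refine ⟨TensorProduct.map p p (Coalgebra.comul a), ?_⟩
  rw [← LinearMap.comp_apply, ← TensorProduct.map_comp, ← LinearMap.lTensor_comp_rTensor,
    LinearMap.comp_apply, h1, h2]

/-- Every element of a coalgebra lies in a finite-dimensional subcoalgebra. -/
theorem exists_finite_subcoalgebra (a : A) :
    ∃ B : Subcoalgebra k A, Module.Finite k B.carrier ∧ a ∈ B.carrier := by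
  -- The span of `Y` is the sub-bimodule generated by `a` over the dual algebra.
  let Y : Set A := {b | ∃ s t : A →ₗ[k] k, b = rightHit s (leftHit t a)}
  have hl : ∀ r : A →ₗ[k] k, ∀ b ∈ Submodule.span k Y, leftHit r b ∈ Submodule.span k Y :=
    fun r b hb => by
      refine (Submodule.span_le (p := (Submodule.span k Y).comap (leftHit r))).2 ?_ hb
      rintro _ ⟨s, t, rfl⟩
      refine Submodule.subset_span ⟨s, conv r t, ?_⟩
      rw [leftHit_rightHit, leftHit_leftHit]
  have hr : ∀ r : A →ₗ[k] k, ∀ b ∈ Submodule.span k Y, rightHit r b ∈ Submodule.span k Y :=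
    fun r b hb => by
      refine (Submodule.span_le (p := (Submodule.span k Y).comap (rightHit r))).2 ?_ hb
      rintro _ ⟨s, t, rfl⟩
      exact Submodule.subset_span ⟨conv s r, t, rightHit_rightHit _ _ _⟩
  refine ⟨⟨Submodule.span k Y, fun b hb => comul_mem_range_of_hit_mem (fun s => hl s b hb)
    fun s => hr s b hb⟩, ?_, Submodule.subset_span ⟨Coalgebra.counit, Coalgebra.counit, ?_⟩⟩
  -- The elements of `Y` are the contractions of the outer factors of `(δ ⊗ 1) (δ a)`.
  · obtain ⟨W, _, hW⟩ := exists_finite_contraction_mem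
      ((Coalgebra.comul (R := k)).rTensor A (Coalgebra.comul (R := k) a))
    refine Submodule.finiteDimensional_of_le (S₂ := W) (Submodule.span_le.2 ?_)
    rintro _ ⟨s, t, rfl⟩
    have h := hW s t
    rwa [contractRight_rTensor] at h
  · rw [leftHit_counit, rightHit_counit]

end LocalFiniteness

/-! ### Modules over the dual of a subcoalgebra as comodules -/

section DualModule

variable {k : Type u} {A : Type v} [Field k] [AddCommGroup A] [Module k A] [Coalgebra k A]

namespace Subcoalgebra

variable (D : Subcoalgebra k A)

/-- The restriction of linear forms from `A` to a subcoalgebra. -/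
noncomputable def restrictDual (s : A →ₗ[k] k) : WithConv (D.carrier →ₗ[k] k) :=
  WithConv.toConv (s ∘ₗ D.carrier.subtype)

lemma restrictDual_surjective : Function.Surjective D.restrictDual := fun f => by
  obtain ⟨s, hs⟩ := LinearMap.exists_extend f.ofConv
  exact ⟨s, congrArg WithConv.toConv hs⟩

lemma restrictDual_conv (s t : A →ₗ[k] k) :
    D.restrictDual (conv s t) = D.restrictDual s * D.restrictDual t := by
  refine congrArg WithConv.toConv (LinearMap.ext fun a => ?_)
  change LinearMap.mul' k k (TensorProduct.map s t (Coalgebra.comul (a : A))) =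
    LinearMap.mul' k k (TensorProduct.map (s ∘ₗ D.carrier.subtype) (t ∘ₗ D.carrier.subtype)
      (D.comulRestrict a))
  rw [← D.map_comulRestrict, TensorProduct.map_comp, LinearMap.comp_apply]

lemma restrictDual_counit : D.restrictDual Coalgebra.counit = 1 := rfl

variable [Module.Finite k D.carrier] (V : Type u) [AddCommGroup V] [Module k V]
  [Module (WithConv (D.carrier →ₗ[k] k)) V] [IsScalarTower k (WithConv (D.carrier →ₗ[k] k)) V]

/-- The coaction of `A` on a module for the dual algebra of a finite-dimensional subcoalgebra. -/
noncomputable def coactOfModule : V →ₗ[k] V ⊗[k] A :=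
  ∑ i, (TensorProduct.mk k V A).flip (Module.finBasis k D.carrier i : A) ∘ₗ
    Algebra.lsmul k k V (WithConv.toConv ((Module.finBasis k D.carrier).coord i))

/-- The restriction of `s` to `D` is the sum of the dual basis vectors weighted by the values of `s`
on the basis. All comodule properties below are read off from this formula. -/
lemma contractRight_coactOfModule (s : A →ₗ[k] k) (x : V) :
    contractRight V s (D.coactOfModule V x) = D.restrictDual s • x := by
  have h : D.restrictDual s = ∑ i, s (Module.finBasis k D.carrier i) •
      WithConv.toConv ((Module.finBasis k D.carrier).coord i) := by
    simp only [← WithConv.toConv_smul, ← WithConv.toConv_sum]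
    refine congrArg WithConv.toConv ((Module.finBasis k D.carrier).ext fun j => ?_)
    simp [Finsupp.single_apply]
  rw [h, Finset.sum_smul, coactOfModule, LinearMap.sum_apply, map_sum]
  exact Finset.sum_congr rfl fun i _ => by simp

/-- A module for the dual algebra of a finite-dimensional subcoalgebra is a right comodule. -/
noncomputable def comoduleOfModule : RightComodule k A V :=
  RightComodule.ofContraction (D.coactOfModule V)
    (fun s t x => by simp only [contractRight_coactOfModule, restrictDual_conv, mul_smul])
    (fun x => by rw [contractRight_coactOfModule, restrictDual_counit, one_smul])

lemma dualAct_comoduleOfModule (s : A →ₗ[k] k) :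
    (D.comoduleOfModule V).dualAct s = Algebra.lsmul k k V (D.restrictDual s) :=
  LinearMap.ext fun x => D.contractRight_coactOfModule V s x

lemma isIrreducible_comoduleOfModule [IsSimpleModule (WithConv (D.carrier →ₗ[k] k)) V] :
    (D.comoduleOfModule V).IsIrreducible := by
  refine ⟨IsSimpleModule.nontrivial (WithConv (D.carrier →ₗ[k] k)) V, fun W hW => ?_⟩
  let W' : Submodule (WithConv (D.carrier →ₗ[k] k)) V :=
    { W with
      smul_mem' := fun f x hx => by
        obtain ⟨s, rfl⟩ := D.restrictDual_surjective f
        rw [← contractRight_coactOfModule]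
        exact contractRight_mem (hW x hx) s }
  refine (eq_bot_or_eq_top W').imp (fun h => ?_) fun h => ?_
  · exact eq_bot_iff.2 fun x hx => (Submodule.mem_bot _).2 ((Submodule.mem_bot _).1 (h.le hx))
  · exact eq_top_iff.2 fun x _ => h.ge (Submodule.mem_top (x := x))

lemma isEndomorphism_comoduleOfModule (f : V →ₗ[WithConv (D.carrier →ₗ[k] k)] V) :
    (D.comoduleOfModule V).IsEndomorphism (f.restrictScalars k) := by
  refine LinearMap.ext fun x => contractRight_ext fun s => ?_
  refine (D.contractRight_coactOfModule V s (f x)).trans ?_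
  rw [LinearMap.comp_apply, contractRight_rTensor]
  exact ((congrArg f (D.contractRight_coactOfModule V s x)).trans (map_smul f _ _)).symm

end Subcoalgebra

end DualModule

end ConstrainedCoalgebra

theorem proposition5p2 {k : Type*} {A : Type*} [Field k] [AddCommGroup A] [Module k A]
    [Coalgebra k A] (hsplit : ConstrainedCoalgebra.IsSplitCoalgebra k A)
    (hA : ConstrainedCoalgebra.IsLocallyQuasiHereditary k A) :
    ConstrainedCoalgebra.IsConstrained k A := by
  open ConstrainedCoalgebra in
  refine le_antisymm (Submodule.span_le.2 ?_) fun a ha => ?_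
  · rintro _ ⟨V, _, _, _, ρ, rfl⟩
    exact ρ.character_mem_cocommutativeElements
  obtain ⟨B, hB, haB⟩ := exists_finite_subcoalgebra (k := k) a
  obtain ⟨D, hBD, hD, hfin, Λ, _, _, ⟨H⟩⟩ := hA B hB
  have := Fintype.ofFinite Λ
  let : ∀ l, Module k (H.L l) := fun l =>
    Module.restrictScalars k (WithConv (D.carrier →ₗ[k] k)) (H.L l)
  let : ∀ l, Module k (H.I l) := fun l =>
    Module.restrictScalars k (WithConv (D.carrier →ₗ[k] k)) (H.I l)
  have : ∀ l, IsScalarTower k (WithConv (D.carrier →ₗ[k] k)) (H.L l) := fun l =>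
    IsScalarTower.restrictScalars k (WithConv (D.carrier →ₗ[k] k)) (H.L l)
  have : ∀ l, IsScalarTower k (WithConv (D.carrier →ₗ[k] k)) (H.I l) := fun l =>
    IsScalarTower.restrictScalars k (WithConv (D.carrier →ₗ[k] k)) (H.I l)
  have := H.simple
  have hfinL : ∀ l, Module.Finite k (H.L l) := fun l =>
    Module.Finite.trans (WithConv (D.carrier →ₗ[k] k)) _
  have hH : H.IsSplit k := fun l f => by
    obtain ⟨c, hc⟩ := hsplit _ _ (D.isIrreducible_comoduleOfModule (H.L l)) _
      (D.isEndomorphism_comoduleOfModule (H.L l) f)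
    exact ⟨c, fun x => by
      rw [algebraMap_smul]
      exact LinearMap.congr_fun hc x⟩
  let a' : D.carrier := ⟨a, hBD haB⟩
  -- Evaluation at `a`, a trace form because `a` is cocommutative and every form on `D` extends to
  -- `A`.
  let τ : WithConv (D.carrier →ₗ[k] k) →ₗ[k] k :=
    { toFun := fun f => f.ofConv a'
      map_add' := fun _ _ => rfl
      map_smul' := fun _ _ => rfl }
  obtain ⟨c, hc⟩ := hH.exists_eq_sum_trace τ fun f g => by
    obtain ⟨s, rfl⟩ := D.restrictDual_surjective f
    obtain ⟨t, rfl⟩ := D.restrictDual_surjective g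
    rw [← D.restrictDual_conv, ← D.restrictDual_conv]
    exact mem_cocommutativeElements_iff.1 ha s t
  have h : a = ∑ l, c l • (D.comoduleOfModule (H.L l)).character := ext_dual (k := k) fun s => by
    simp only [map_sum, map_smul, RightComodule.apply_character, D.dualAct_comoduleOfModule]
    exact hc (D.restrictDual s)
  rw [h]
  exact Submodule.sum_mem _ fun l _ => Submodule.smul_mem _ _
    (Submodule.subset_span ⟨_, _, _, hfinL l, _, rfl⟩)
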